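/- Let $r\ge 1$ and $n(1),\dots,n(r)\ge 1$ be integers, and put $n=n(1)+\cdots+n(r)$. For each $N\geq 1$ let $X_N$ be an $N\times N$ complex Gaussian random matrix, i.e. its entries are independent centered (circularly symmetric) complex Gaussian random variables of variance $1/N$. Let $D_1^{(N)},\dots,D_n^{(N)}$ (repetitions allowed) be non-random complex $N\times N$ matrices which converge in distribution as $N\to\infty$ to elements $d_1,\dots,d_n$ of a unital complex $*$-algebra $\mathcal A$ with a tracial state $\psi$, that is, $$\lim_{N\to\infty}\tfrac1N\mathrm{Tr}\bigl[D^{(N)}_{i_1}\cdots D^{(N)}_{i_k}\bigr]=\psi(d_{i_1}\cdots d_{i_k})\qquad\text{for all }k\text{ and all } i_1,\dots,i_k\in\{1,\dots,n\}.$$ Put $P_N(D_i):=X_N^*D_i^{(N)}X_N$ and, for $1\le j\le r$, $$Y_j^{(N)}:=\mathrm{Tr}\bigl[P_N(D_{n(1)+\cdots+n(j-1)+1})\cdots P_N(D_{n(1)+\cdots+n(j)})\bigr].$$ For random variables $Y_1,\dots,Y_r$ let $$\mathrm k_r\{Y_1,\dots,Y_r\}=\sum_{A}(-1)^{\#A-1}(\#A-1)!\prod_{B\in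 A}\mathrm E\Bigl\{\prod_{i\in B}Y_i\Bigr\}$$ (sum over all partitions $A$ of $\{1,\dots,r\}$, where $\#A$ is the number of blocks) be their $r$-th classical cumulant. For a permutation $\pi$ let $\#(\pi)$ be the number of its cycles (fixed points included), and for $\pi$ in the symmetric group $S_n$ put $$\psi_\pi(a_1,\dots,a_n)=\prod_{(i_1,i_2,\dots,i_l)\text{ cycle of }\pi}\psi(a_{i_1}a_{i_2}\cdots a_{i_l}).$$ Let $\gamma\in S_n$ be the permutation with the $r$ cycles $(1,\dots,n(1))$, $(n(1)+1,\dots,n(1)+n(2))$, $\dots$, $(n(1)+\cdots+n(r-1)+1,\dots,n)$, and let $S_{NC}(n(1),\dots,n(r))$ be the set of multi-annular non-crossing permutations, i.e. of all $\pi\in S_n$ such that the group generated by $\pi$ and $\gamma$ acts transitively on $\{1,\dots,n\}$ and $$\#(\pi)+\#(\gamma\pi^{-1})=n+2-r.$$ Then all products of the variables $Y_j^{(N)}$ that occur in the cumulant are integrable, and $$\lim_{N\to\infty}N^{r-2}\,\mathrm k_r\bigl\{Y_1^{(N)},\dots,Y_r^{(N)}\bigr\}=\sum_{\pi\in S_{NC}(n(1),\dots,n(r))}\psi_\pi(d_1,\dots,d_n).$$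 -/

import Mathlib

open MeasureTheory ProbabilityTheory Filter Topology

noncomputable section

namespace CompoundWishart

/-! ### Permutations on several circles -/

/-- The points on `r` circles, with `n j` points on the `j`-th circle. The point `⟨j, k⟩` is the
`k`-th point of the circle `j`; in the linear labelling by `1, …, n(1) + ⋯ + n(r)` it is the number
`n(1) + ⋯ + n(j - 1) + k` (with `j` and `k` counted from one). -/
abbrev Point {r : ℕ} (n : Fin r → ℕ) : Type := Σ j : Fin r, Fin (n j)

/-- The permutation `γ` with the `r` cycles `(1, …, n(1)) (n(1) + 1, …, n(1) + n(2)) ⋯`: it rotates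
every circle by one step. -/
def gammaPerm {r : ℕ} (n : Fin r → ℕ) : Equiv.Perm (Point n) :=
  Equiv.Perm.sigmaCongrRight fun j => finRotate (n j)

/-- The type of cycles of a permutation, fixed points included. -/
abbrev Cycles {α : Type*} (π : Equiv.Perm α) : Type _ :=
  Quotient (Equiv.Perm.SameCycle.setoid π)

/-- The number `#(π)` of cycles of `π`, fixed points included. -/
def numCycles {α : Type*} (π : Equiv.Perm α) : ℕ := Nat.card (Cycles π)

/-- `τ` is a multi-annular non-crossing permutation: it connects the circles (the group generated
by `τ` and `γ` is transitive) and it is planar,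
`#(τ) + #(γ τ⁻¹) = n(1) + ⋯ + n(r) + 2 - r`. -/
def IsAnnularNonCrossing {r : ℕ} (n : Fin r → ℕ) (τ : Equiv.Perm (Point n)) : Prop :=
  (∀ x y : Point n, ∃ g ∈ Subgroup.closure {τ, gammaPerm n}, g x = y) ∧
    numCycles τ + numCycles (gammaPerm n * τ⁻¹) + r = (∑ j, n j) + 2

open Classical in
/-- The finite set `S_NC(n(1), …, n(r))`. -/
def SNC {r : ℕ} (n : Fin r → ℕ) : Finset (Equiv.Perm (Point n)) :=
  Finset.univ.filter (IsAnnularNonCrossing n)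

/-- The product `a (x) * a (π x) * a (π² x) * ⋯` once around the cycle of `π` through `x`. -/
def cycleWord {α A : Type*} [Monoid A] (π : Equiv.Perm α) (a : α → A) (x : α) : A :=
  ((List.range (Function.minimalPeriod π x)).map fun k => a ((π ^ k) x)).prod

/-- `ψ_π`: the product over the cycles of `π` of the value of `ψ` at the product around the cycle.
Each cycle is read from some starting point; for tracial `ψ` the choice is irrelevant, see
`cycleWord_sameCycle`. -/
def psiPerm {α A R : Type*} [Finite α] [Monoid A] [CommMonoid R] (ψ : A → R)
    (π : Equiv.Perm α) (a : α → A) : R :=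
  letI := Fintype.ofFinite (Cycles π)
  ∏ c : Cycles π, ψ (cycleWord π a c.out)

theorem cycleWord_apply {α A R : Type*} [Finite α] [Monoid A] (ψ : A → R)
    (hψ : ∀ x y, ψ (x * y) = ψ (y * x)) (π : Equiv.Perm α) (a : α → A) (x : α) :
    ψ (cycleWord π a (π x)) = ψ (cycleWord π a x) := by
  have hx : x ∈ Function.periodicPts π :=
    Function.Injective.mem_periodicPts π.injective x
  have hp : Function.minimalPeriod π (π x) = Function.minimalPeriod π x :=
    Function.minimalPeriod_apply hx
  have hpos := Function.minimalPeriod_pos_of_mem_periodicPts hx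
  unfold cycleWord
  rw [hp]
  obtain ⟨m, hm⟩ : ∃ m, Function.minimalPeriod π x = m + 1 := ⟨_, (Nat.succ_pred hpos.ne').symm⟩
  have hend : (π ^ (m + 1)) x = x := by
    have h := Function.isPeriodicPt_minimalPeriod π x
    rw [hm] at h
    rw [Equiv.Perm.coe_pow]
    exact h
  have hs : ∀ k, (π ^ k) (π x) = (π ^ (k + 1)) x := fun k => by
    rw [pow_succ, Equiv.Perm.mul_apply]
  simp only [hs]
  rw [hm]
  conv_lhs => rw [List.range_succ]
  conv_rhs => rw [List.range_succ_eq_map]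
  simp only [List.map_append, List.map_cons, List.map_nil, List.prod_append, List.prod_cons,
    List.prod_nil, mul_one, List.map_map, hend, pow_zero, Equiv.Perm.one_apply]
  rw [hψ]
  rfl

/-- The value of a trace at the product around a cycle does not depend on the starting point. -/
theorem cycleWord_sameCycle {α A R : Type*} [Finite α] [Monoid A] (ψ : A → R)
    (hψ : ∀ x y, ψ (x * y) = ψ (y * x)) (π : Equiv.Perm α) (a : α → A) {x y : α}
    (h : π.SameCycle x y) : ψ (cycleWord π a x) = ψ (cycleWord π a y) := by
  obtain ⟨k, rfl⟩ := h.exists_nat_pow_eq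
  clear h
  induction k with
  | zero => rfl
  | succ k ih => rw [pow_succ', Equiv.Perm.mul_apply, cycleWord_apply ψ hψ, ← ih]

/-! ### Tracial states and convergence in distribution -/

/-- `ψ` is a tracial state on the unital complex `*`-algebra `A`. -/
structure IsTracialState {A : Type*} [Ring A] [StarRing A] [Algebra ℂ A] (ψ : A →ₗ[ℂ] ℂ) :
    Prop where
  map_one : ψ 1 = 1
  nonneg_re : ∀ a, 0 ≤ (ψ (star a * a)).re
  im_eq_zero : ∀ a, (ψ (star a * a)).im = 0
  tracial : ∀ a b, ψ (a * b) = ψ (b * a)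

/-- The normalized trace of an `N × N` matrix. -/
def normTrace {N : ℕ} (M : Matrix (Fin N) (Fin N) ℂ) : ℂ := (N : ℂ)⁻¹ * M.trace

/-- The matrices `D i N` (of size `N × N`) converge in distribution to the elements `d i` of
`(A, ψ)`: every moment `tr[D_{i₁} ⋯ D_{iₖ}]` converges to `ψ(d_{i₁} ⋯ d_{iₖ})`. -/
def ConvergesInDistribution {ι A : Type*} [Ring A] [Algebra ℂ A]
    (D : ι → (N : ℕ) → Matrix (Fin N) (Fin N) ℂ) (ψ : A →ₗ[ℂ] ℂ) (d : ι → A) : Prop :=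
  ∀ w : List ι, Tendsto (fun N => normTrace ((w.map fun i => D i N).prod)) atTop
    (𝓝 (ψ (w.map d).prod))

/-! ### Random matrices and cumulants -/

/-- The centered complex Gaussian distribution of variance `v`: real and imaginary parts are
independent real Gaussians with mean `0` and variance `v / 2`. -/
def complexGaussian (v : NNReal) : Measure ℂ :=
  ((gaussianReal 0 (v / 2)).prod (gaussianReal 0 (v / 2))).map fun p : ℝ × ℝ => (⟨p.1, p.2⟩ : ℂ)

/-- `X` is an `N × N` complex Gaussian random matrix: its entries are independent centered complex
Gaussian random variables of variance `1 / N`. -/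
structure IsComplexGaussianMatrix {Ω : Type*} [MeasurableSpace Ω] (μ : Measure Ω) {N : ℕ}
    (X : Ω → Matrix (Fin N) (Fin N) ℂ) : Prop where
  hasLaw : ∀ i j, HasLaw (fun ω => X ω i j) (complexGaussian (N : NNReal)⁻¹) μ
  indep : iIndepFun (fun (p : Fin N × Fin N) ω => X ω p.1 p.2) μ

/-- The classical cumulant `k_r(Y_1, …, Y_r)` (the sum runs over the partitions of the index
set). -/
def cumulant {Ω : Type*} [MeasurableSpace Ω] (μ : Measure Ω) {r : ℕ} (Y : Fin r → Ω → ℂ) : ℂ :=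
  ∑ P : Finpartition (Finset.univ : Finset (Fin r)),
    (-1 : ℂ) ^ (P.parts.card - 1) * ((P.parts.card - 1).factorial : ℂ) *
      ∏ B ∈ P.parts, ∫ ω, ∏ i ∈ B, Y i ω ∂μ

/-- The compound Wishart matrix `P_N(D) = X^* D X`. -/
def wishart {N : ℕ} (X D : Matrix (Fin N) (Fin N) ℂ) : Matrix (Fin N) (Fin N) ℂ :=
  X.conjTranspose * D * X

/-- The (unnormalized) trace of the product, in increasing order, of the compound Wishart matrices
that belong to the points of the `j`-th circle. -/
def wishartTrace {r : ℕ} (n : Fin r → ℕ) {N : ℕ} (X : Matrix (Fin N) (Fin N) ℂ)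
    (D : Point n → Matrix (Fin N) (Fin N) ℂ) (j : Fin r) : ℂ :=
  ((List.ofFn fun k : Fin (n j) => wishart X (D ⟨j, k⟩)).prod).trace

end CompoundWishart

end

noncomputable section

namespace CompoundWishart

/-! ### Functions invariant under a permutation -/

/-! The proof is a genus expansion. Expanding the traces turns a product of the `Y_j` into a sum
over index functions `a, b, c` on the points. The Wick formula (`prod_gaussMoment`,
`integral_monomial`) writes the expectation of each Gaussian monomial as `N⁻ⁿ` times a sum over
permutations `σ` pairing the conjugated factors with the plain ones. For fixed `σ`, summing over `a`
counts functions invariant under `γσ⁻¹` and gives `N ^ #(γσ⁻¹)`; summing over `b` gives the product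
of the traces of the `D`-words around the cycles of `σ`, that is `N ^ #σ` times normalized traces,
which converge.

A product of expectations over the blocks of a partition is a single expectation in which different
blocks use independent copies of `X`. Its Wick sum therefore keeps exactly the `σ` that respect the
blocks (`prod_integral_wishartTrace`). Möbius inversion (`sum_moebius`) then shows that the cumulant
retains only the `σ` that connect all the circles, each with coefficient one
(`cumulant_wishartTrace`).

After multiplication by `N ^ (r - 2)`, such a `σ` carries the power `r - 2 - n + #σ + #(γσ⁻¹)` of
`N`. The genus inequality `numCycles_add_le` makes this exponent nonpositive, and it vanishes
precisely for the multi-annular non-crossing permutations, which alone survive in the limit. -/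

theorem eq_of_sameCycle {α β : Type*} [Finite α] {g : Equiv.Perm α} {f : α → β}
    (hf : ∀ x, f (g x) = f x) {x y : α} (h : g.SameCycle x y) : f x = f y := by
  obtain ⟨k, rfl⟩ := h.exists_nat_pow_eq
  clear h
  induction k with
  | zero => rfl
  | succ k ih => rw [pow_succ', Equiv.Perm.mul_apply, hf, ← ih]

theorem mk_apply {α : Type*} (g : Equiv.Perm α) (x : α) :
    (Quotient.mk (Equiv.Perm.SameCycle.setoid g) (g x)) = Quotient.mk _ x :=
  Quotient.sound ((Equiv.Perm.sameCycle_apply_left).2 (Equiv.Perm.SameCycle.refl g x))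

/-- Functions invariant under a permutation are functions on the set of its cycles. -/
def invariantEquiv {α : Type*} [Finite α] (g : Equiv.Perm α) (β : Type*) :
    {f : α → β // ∀ x, f (g x) = f x} ≃ (Cycles g → β) where
  toFun f := Quotient.lift f.1 fun _ _ h => eq_of_sameCycle f.2 h
  invFun h := ⟨fun x => h (Quotient.mk _ x), fun x => congrArg h (mk_apply g x)⟩
  left_inv f := rfl
  right_inv h := by
    funext c
    induction c using Quotient.inductionOn
    rfl

theorem card_invariant {α : Type*} [Finite α] (g : Equiv.Perm α) (N : ℕ) :
    Nat.card {f : α → Fin N // ∀ x, f (g x) = f x} = N ^ numCycles g := by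
  rw [Nat.card_congr (invariantEquiv g (Fin N)), Nat.card_fun, Nat.card_fin]
  rfl

/-! ### The genus inequality -/

/-- The action of a permutation on functions, subtracted from the identity. -/
def oneSub {α : Type*} (g : Equiv.Perm α) : (α → ℚ) →ₗ[ℚ] (α → ℚ) :=
  LinearMap.id - LinearMap.funLeft ℚ ℚ g

@[simp] theorem oneSub_apply {α : Type*} (g : Equiv.Perm α) (f : α → ℚ) (x : α) :
    oneSub g f x = f x - f (g x) := rfl

/-- The invariant functions are the pullbacks of functions on the set of cycles; this converts cycle
counts into ranks. -/
theorem finrank_ker_oneSub {α : Type*} [Finite α] (g : Equiv.Perm α) :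
    Module.finrank ℚ (LinearMap.ker (oneSub g)) = numCycles g := by
  have hr : LinearMap.ker (oneSub g) =
      LinearMap.range (LinearMap.funLeft ℚ ℚ (Quotient.mk (Equiv.Perm.SameCycle.setoid g))) := by
    ext f
    rw [LinearMap.mem_ker, LinearMap.mem_range]
    constructor
    · intro h
      have h' : ∀ x, f (g x) = f x := fun x => by
        have := congrFun h x
        rw [oneSub_apply, Pi.zero_apply, sub_eq_zero] at this
        exact this.symm
      exact ⟨invariantEquiv g ℚ ⟨f, h'⟩, rfl⟩
    · rintro ⟨h, rfl⟩
      funext x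
      rw [oneSub_apply, LinearMap.funLeft_apply, LinearMap.funLeft_apply, mk_apply, sub_self]
      rfl
  let _ := Fintype.ofFinite (Cycles g)
  rw [hr, LinearMap.finrank_range_of_inj
    (LinearMap.funLeft_injective_of_surjective _ _ _ Quotient.mk_surjective),
    Module.finrank_fintype_fun_eq_card, numCycles, Nat.card_eq_fintype_card]

theorem finrank_range_oneSub {α : Type*} [Finite α] (g : Equiv.Perm α) :
    Module.finrank ℚ (LinearMap.range (oneSub g)) + numCycles g = Nat.card α := by
  let _ := Fintype.ofFinite α
  rw [← finrank_ker_oneSub, LinearMap.finrank_range_add_finrank_ker,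
    Module.finrank_fintype_fun_eq_card, Nat.card_eq_fintype_card]

theorem apply_eq_of_mem_closure {α β : Type*} {s : Set (Equiv.Perm α)} {f : α → β}
    (hf : ∀ g ∈ s, ∀ x, f (g x) = f x) {g : Equiv.Perm α} (hg : g ∈ Subgroup.closure s) (x : α) :
    f (g x) = f x := by
  induction hg using Subgroup.closure_induction generalizing x with
  | mem g hg => exact hf g hg x
  | one => rfl
  | mul g h _ _ hg hh => rw [Equiv.Perm.mul_apply, hg, hh]
  | inv g _ hg => rw [← hg (g⁻¹ x), ← Equiv.Perm.mul_apply, mul_inv_cancel, Equiv.Perm.one_apply]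

/-- The genus inequality for two permutations that generate a transitive group. -/
theorem numCycles_add_le {α : Type*} [Finite α] (σ γ : Equiv.Perm α)
    (h : ∀ x y : α, ∃ g ∈ Subgroup.closure {σ, γ}, g x = y) :
    numCycles σ + numCycles (γ * σ⁻¹) + numCycles γ ≤ Nat.card α + 2 := by
  classical
  let _ := Fintype.ofFinite α
  rcases isEmpty_or_nonempty α with hα | ⟨⟨x₀⟩⟩
  · have h0 : ∀ g : Equiv.Perm α, numCycles g = 0 := fun g => by
      have : IsEmpty (Cycles g) := ⟨fun c => hα.elim c.out⟩
      exact Nat.card_of_isEmpty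
    simp [h0]
  set τ := γ * σ⁻¹ with hτ
  have hτσ : ∀ x, τ (σ x) = γ x := fun x => by simp [hτ]
  -- The maps `β` and `δ` form a complex, since `(f - f∘σ) + (f - f∘τ)∘σ - (f - f∘γ) = 0` when `τσ =
  -- γ`. By transitivity both `ker β` and `coker δ` have dimension at most one, while the middle
  -- term has dimension `3|α|` minus the three cycle counts. Comparing `rank β` with `dim ker δ`
  -- gives the inequality.
  let β : (α → ℚ) →ₗ[ℚ] LinearMap.range (oneSub σ) × LinearMap.range (oneSub τ) ×
      LinearMap.range (oneSub γ) :=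
    (oneSub σ).rangeRestrict.prod ((oneSub τ).rangeRestrict.prod (oneSub γ).rangeRestrict)
  let δ : (LinearMap.range (oneSub σ) × LinearMap.range (oneSub τ) ×
      LinearMap.range (oneSub γ)) →ₗ[ℚ] (α → ℚ) :=
    (LinearMap.range (oneSub σ)).subtype.coprod
      (((LinearMap.funLeft ℚ ℚ σ) ∘ₗ (LinearMap.range (oneSub τ)).subtype).coprod
        (-(LinearMap.range (oneSub γ)).subtype))
  have hle : LinearMap.range β ≤ LinearMap.ker δ := by
    rintro _ ⟨f, rfl⟩
    rw [LinearMap.mem_ker]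
    funext x
    simp [β, δ, LinearMap.funLeft_apply, hτσ]
  have hβ : Module.finrank ℚ (LinearMap.ker β) ≤ 1 := by
    refine finrank_le_one ⟨fun _ => 1, ?_⟩ ?_
    · rw [LinearMap.mem_ker]
      ext x <;> simp [β]
    · rintro ⟨f, hf⟩
      refine ⟨f x₀, Subtype.ext (funext fun x => ?_)⟩
      rw [LinearMap.mem_ker] at hf
      have h1 : ∀ x, f (σ x) = f x := fun x => by
        have := congrFun (congrArg (fun z => (z.1 : α → ℚ)) hf) x
        exact (sub_eq_zero.1 this).symm
      have h2 : ∀ x, f (γ x) = f x := fun x => by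
        have := congrFun (congrArg (fun z => (z.2.2 : α → ℚ)) hf) x
        exact (sub_eq_zero.1 this).symm
      obtain ⟨g, hg, rfl⟩ := h x₀ x
      have := apply_eq_of_mem_closure (f := f) (s := {σ, γ})
        (by rintro g (rfl | rfl); exacts [h1, h2]) hg x₀
      exact (mul_one (f x₀)).trans this.symm
  have hδ : Module.finrank ℚ ((α → ℚ) ⧸ LinearMap.range δ) ≤ 1 := by
    -- The class of the point mass at `x`. As `oneSub g` sends the point mass at `g x` to the
    -- difference of those at `g x` and `x`, transitivity identifies all these classes, and they
    -- span the cokernel.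
    let e : α → (α → ℚ) ⧸ LinearMap.range δ := fun x =>
      (LinearMap.range δ).mkQ (Pi.single x 1)
    have key : ∀ g : Equiv.Perm α, (∀ v : α → ℚ, oneSub g v ∈ LinearMap.range δ) →
        ∀ x, e (g x) = e x := by
      intro g hg x
      refine (Submodule.Quotient.eq _).2 ?_
      convert hg (Pi.single (g x) 1) using 1
      funext y
      simp [Pi.single_apply, eq_comm]
    have h1 : ∀ v : α → ℚ, oneSub σ v ∈ LinearMap.range δ := fun v =>
      ⟨(⟨oneSub σ v, v, rfl⟩, 0, 0), by simp [δ]⟩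
    have h2 : ∀ v : α → ℚ, oneSub γ v ∈ LinearMap.range δ := fun v =>
      ⟨(0, 0, -⟨oneSub γ v, v, rfl⟩), by simp [δ]⟩
    have he : ∀ x, e x = e x₀ := fun x => by
      obtain ⟨g, hg, rfl⟩ := h x₀ x
      exact apply_eq_of_mem_closure (f := e) (s := {σ, γ})
        (by rintro g (rfl | rfl); exacts [key _ h1, key _ h2]) hg x₀
    refine finrank_le_one (e x₀) fun w => ?_
    obtain ⟨v, rfl⟩ := Submodule.mkQ_surjective _ w
    refine ⟨∑ x, v x, ?_⟩
    conv_rhs => rw [← Finset.univ_sum_single v]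
    rw [map_sum, Finset.sum_smul]
    refine Finset.sum_congr rfl fun x _ => ?_
    rw [← he x, ← LinearMap.map_smul, ← Pi.single_smul, smul_eq_mul, mul_one]
  have e1 := LinearMap.finrank_range_add_finrank_ker β
  have e2 := LinearMap.finrank_range_add_finrank_ker δ
  have e3 := Submodule.finrank_quotient_add_finrank (LinearMap.range δ)
  have e4 := Submodule.finrank_mono hle
  have e5 : Module.finrank ℚ (α → ℚ) = Nat.card α := by
    rw [Module.finrank_fintype_fun_eq_card, Nat.card_eq_fintype_card]
  rw [Module.finrank_prod, Module.finrank_prod] at e2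
  have f1 := finrank_range_oneSub σ
  have f2 := finrank_range_oneSub τ
  have f3 := finrank_range_oneSub γ
  omega

/-! ### Möbius inversion on partitions -/

/-- The linear coefficient of `X (X - 1) ⋯ (X - k)` is the weight of a partition with `k + 1` blocks
in the cumulant. -/
theorem coeff_one_descPochhammer (k : ℕ) :
    (descPochhammer ℤ (k + 1)).coeff 1 = (-1) ^ k * (k.factorial : ℤ) := by
  induction k with
  | zero => simp
  | succ k ih =>
    have h0 : (descPochhammer ℤ (k + 1)).coeff 0 = 0 := by
      rw [descPochhammer_succ_left, Polynomial.coeff_X_mul_zero]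
    rw [descPochhammer_succ_right, mul_sub, Polynomial.coeff_sub,
      Polynomial.coeff_mul_X, h0, ← Polynomial.C_eq_natCast, Polynomial.coeff_mul_C, ih,
      Nat.factorial_succ]
    push_cast
    ring

section Partition

variable {ι : Type*} [Fintype ι] [DecidableEq ι]

/-- The block of a partition of the whole type that contains a given element. -/
def block (P : Finpartition (Finset.univ : Finset ι)) (i : ι) : P.parts :=
  ⟨P.part i, (P.part_mem).2 (Finset.mem_univ i)⟩

theorem block_surjective (P : Finpartition (Finset.univ : Finset ι)) :
    Function.Surjective (block P) := by
  rintro ⟨B, hB⟩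
  obtain ⟨i, hi⟩ := P.nonempty_of_mem_parts hB
  exact ⟨i, Subtype.ext (P.part_eq_of_mem hB hi)⟩

theorem block_eq_iff_mem (P : Finpartition (Finset.univ : Finset ι)) (i : ι) (c : P.parts) :
    block P i = c ↔ i ∈ c.1 := by
  rw [Subtype.ext_iff]
  exact P.part_eq_iff_mem c.2

theorem exists_block_eq_iff {κ : Type*} [DecidableEq κ] (f : ι → κ) :
    ∃ P : Finpartition (Finset.univ : Finset ι), ∀ i j, block P i = block P j ↔ f i = f j := by
  refine ⟨Finpartition.ofSetoid (Setoid.ker f), fun i j => ?_⟩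
  rw [Subtype.ext_iff]
  change Finpartition.part _ i = Finpartition.part _ j ↔ _
  rw [eq_comm, ← Finpartition.mem_part_iff_part_eq_part _ (Finset.mem_univ _) (Finset.mem_univ _),
    Finpartition.mem_part_ofSetoid_iff_rel]
  rfl

theorem finpartition_ext {P Q : Finpartition (Finset.univ : Finset ι)}
    (h : ∀ i j, block P i = block P j ↔ block Q i = block Q j) : P = Q := by
  have hp : ∀ i, P.part i = Q.part i := fun i => by
    ext j
    have := h j i
    rw [block_eq_iff_mem, block_eq_iff_mem] at this
    exact this
  ext B
  constructor
  · intro hB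
    obtain ⟨i, hi⟩ := block_surjective P ⟨B, hB⟩
    have : B = Q.part i := by rw [← hp]; exact (congrArg Subtype.val hi).symm
    rw [this]
    exact (block Q i).2
  · intro hB
    obtain ⟨i, hi⟩ := block_surjective Q ⟨B, hB⟩
    have : B = P.part i := by rw [hp]; exact (congrArg Subtype.val hi).symm
    rw [this]
    exact (block P i).2

/-- Colourings that distinguish exactly the blocks of `P`. -/
theorem card_colorings (P : Finpartition (Finset.univ : Finset ι)) (x : ℕ) :
    Nat.card {f : ι → Fin x // ∀ i j, block P i = block P j ↔ f i = f j} =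
      x.descFactorial P.parts.card := by
  rw [← Fintype.card_coe P.parts]
  conv_rhs => rw [← Fintype.card_fin x]
  rw [← Fintype.card_embedding_eq, ← Nat.card_eq_fintype_card]
  refine (Nat.card_congr (Equiv.ofBijective (fun e : P.parts ↪ Fin x =>
    (⟨fun i => e (block P i), fun i j => e.injective.eq_iff.symm⟩ :
      {f : ι → Fin x // ∀ i j, block P i = block P j ↔ f i = f j})) ⟨?_, ?_⟩)).symm
  · intro e e' h
    ext c
    obtain ⟨i, rfl⟩ := block_surjective P c
    exact congrArg Fin.val (congrFun (congrArg Subtype.val h) i)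
  · rintro ⟨f, hf⟩
    have hs : ∀ c, block P ((block_surjective P c).choose) = c := fun c =>
      (block_surjective P c).choose_spec
    refine ⟨⟨fun c => f ((block_surjective P c).choose), fun c c' h => ?_⟩, ?_⟩
    · rw [← hs c, ← hs c']
      exact (hf _ _).2 h
    · refine Subtype.ext (funext fun i => ?_)
      exact (hf _ _).1 (hs _)

-- Colourings constant on the classes of `s` are sorted by their partition into level sets, which is
-- coarser than `s`.
open Classical in
theorem sum_descFactorial (s : Setoid ι) (x : ℕ) :
    ∑ P : Finpartition (Finset.univ : Finset ι) with ∀ i j, s i j → block P i = block P j,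
      x.descFactorial P.parts.card = x ^ Nat.card (Quotient s) := by
  let F := {f : ι → Fin x // ∀ i j, s i j → f i = f j}
  have e1 : Nat.card F = x ^ Nat.card (Quotient s) := by
    conv_rhs => rw [← Nat.card_fin x, ← Nat.card_fun]
    exact Nat.card_congr
      { toFun := fun f => Quotient.lift f.1 f.2
        invFun := fun h => ⟨fun i => h (Quotient.mk _ i), fun i j hij =>
          congrArg h (Quotient.sound hij)⟩
        left_inv := fun f => rfl
        right_inv := fun h => by
          funext c
          induction c using Quotient.inductionOn
          rfl }
  let T := {P : Finpartition (Finset.univ : Finset ι) // ∀ i j, s i j → block P i = block P j}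
  have e2 : Nat.card F = Nat.card (Σ P : T, {f : ι → Fin x // ∀ i j,
      block P.1 i = block P.1 j ↔ f i = f j}) := by
    refine (Nat.card_congr (Equiv.ofBijective (fun p => (⟨p.2.1, fun i j hij =>
      (p.2.2 i j).1 (p.1.2 i j hij)⟩ : F)) ⟨?_, ?_⟩)).symm
    · rintro ⟨⟨P, hP⟩, ⟨f, hf⟩⟩ ⟨⟨Q, hQ⟩, ⟨g, hg⟩⟩ h
      obtain rfl : f = g := congrArg Subtype.val h
      obtain rfl : P = Q := finpartition_ext fun i j => (hf i j).trans (hg i j).symm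
      rfl
    · rintro ⟨f, hf⟩
      obtain ⟨P, hP⟩ := exists_block_eq_iff f
      exact ⟨⟨⟨P, fun i j hij => (hP i j).2 (hf i j hij)⟩, ⟨f, hP⟩⟩, rfl⟩
  rw [← e1, e2, Nat.card_sigma]
  simp only [card_colorings]
  exact (Finset.sum_subtype_eq_sum_filter (s := Finset.univ) _).symm.trans
    (Finset.sum_congr (by ext; simp) fun _ _ => rfl)

open Classical in
/-- The Möbius function of the partition lattice. -/
theorem sum_moebius [Nonempty ι] (s : Setoid ι) :
    ∑ P : Finpartition (Finset.univ : Finset ι) with ∀ i j, s i j → block P i = block P j,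
      ((-1) ^ (P.parts.card - 1) * ((P.parts.card - 1).factorial : ℤ)) =
      if Nat.card (Quotient s) = 1 then 1 else 0 := by
  -- The colouring count holds for every natural `x`, hence as an identity of polynomials; the claim
  -- compares coefficients of `X`.
  have hp : (∑ P : Finpartition (Finset.univ : Finset ι) with ∀ i j, s i j → block P i = block P j,
      descPochhammer ℤ P.parts.card) = Polynomial.X ^ Nat.card (Quotient s) := by
    refine Polynomial.eq_of_infinite_eval_eq _ _
      (Set.Infinite.mono ?_ (Set.infinite_range_of_injective (Nat.cast_injective (R := ℤ))))
    rintro _ ⟨x, rfl⟩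
    rw [Set.mem_ofPred_eq, Polynomial.eval_finsetSum, Polynomial.eval_pow, Polynomial.eval_X]
    simp only [descPochhammer_eval_eq_descFactorial]
    rw [← Nat.cast_sum, sum_descFactorial, Nat.cast_pow]
  have := congrArg (fun p => Polynomial.coeff p 1) hp
  simp only [Polynomial.finsetSum_coeff, Polynomial.coeff_X_pow] at this
  rw [← Finset.sum_congr rfl fun P _ => ?_]
  · rw [this]
    simp only [eq_comm]
  · have hP : 0 < P.parts.card := Finset.card_pos.2 ⟨_, (block P (Classical.arbitrary ι)).2⟩
    obtain ⟨k, hk⟩ : ∃ k, P.parts.card = k + 1 := ⟨_, (Nat.succ_pred hP.ne').symm⟩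
    rw [hk, coeff_one_descPochhammer, Nat.add_sub_cancel]

end Partition

/-! ### Connected permutations -/

section Connected

variable {r : ℕ} {n : Fin r → ℕ}

/-- The finest partition of the set of circles that is respected by a permutation of the points. -/
def circleSetoid (σ : Equiv.Perm (Point n)) : Setoid (Fin r) :=
  Relation.EqvGen.setoid fun i j => ∃ x : Point n, x.1 = i ∧ (σ x).1 = j

theorem circleSetoid_le_iff {κ : Type*} (σ : Equiv.Perm (Point n)) (f : Fin r → κ) :
    (∀ i j, circleSetoid σ i j → f i = f j) ↔ ∀ x, f (σ x).1 = f x.1 := by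
  constructor
  · exact fun h x => (h _ _ (Relation.EqvGen.rel _ _ ⟨x, rfl, rfl⟩)).symm
  · intro h i j hij
    induction (hij : Relation.EqvGen _ i j) with
    | rel i j hij => obtain ⟨x, rfl, rfl⟩ := hij; exact (h x).symm
    | refl => rfl
    | symm i j h ih => exact ih.symm
    | trans i j k h h' ih ih' => exact ih.trans ih'

theorem gammaPerm_fst (x : Point n) : (gammaPerm n x).1 = x.1 := rfl

theorem finRotate_pow_eq {m : ℕ} (a b : Fin m) : ∃ k : ℕ, (finRotate m ^ k) a = b := by
  obtain ⟨m, rfl⟩ : ∃ k, m = k + 1 := ⟨m - 1, by have := a.2; omega⟩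
  have : ∀ k : ℕ, ((finRotate (m + 1) ^ k) a).val = (a.val + k) % (m + 1) := fun k => by
    induction k with
    | zero => simp [Nat.mod_eq_of_lt a.2]
    | succ k ih =>
      rw [pow_succ', Equiv.Perm.mul_apply, finRotate_apply, Fin.val_add, ih, Fin.val_one',
        ← Nat.add_mod, add_assoc]
  -- Adding a full turn keeps the natural subtraction from truncating.
  refine ⟨b.val + (m + 1) - a.val, Fin.ext ?_⟩
  have ha := a.2
  rw [this, show a.val + (b.val + (m + 1) - a.val) = b.val + (m + 1) by omega,
    Nat.add_mod_right, Nat.mod_eq_of_lt b.2]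

theorem gammaPerm_pow_eq {x y : Point n} (h : x.1 = y.1) : ∃ k : ℕ, (gammaPerm n ^ k) x = y := by
  obtain ⟨i, a⟩ := x
  obtain ⟨j, b⟩ := y
  obtain rfl : i = j := h
  obtain ⟨k, rfl⟩ := finRotate_pow_eq a b
  refine ⟨k, ?_⟩
  induction k with
  | zero => rfl
  | succ k ih => rw [pow_succ', Equiv.Perm.mul_apply, ih, pow_succ']; rfl

/-- Powers of `γ` move freely within a circle, so only the passage between circles matters. Circles
must be nonempty: an empty one would be a class of its own, invisible to the group action. -/
theorem transitive_iff (hr : 1 ≤ r) (hn : ∀ j, 1 ≤ n j) (σ : Equiv.Perm (Point n)) :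
    (∀ x y : Point n, ∃ g ∈ Subgroup.closure {σ, gammaPerm n}, g x = y) ↔
      Nat.card (Quotient (circleSetoid σ)) = 1 := by
  have hpt : ∀ j, ∃ x : Point n, x.1 = j := fun j => ⟨⟨j, ⟨0, hn j⟩⟩, rfl⟩
  have hσ : σ ∈ Subgroup.closure {σ, gammaPerm n} := Subgroup.subset_closure (by simp)
  have hγ : gammaPerm n ∈ Subgroup.closure {σ, gammaPerm n} := Subgroup.subset_closure (by simp)
  rw [Nat.card_eq_one_iff_unique]
  constructor
  · intro h
    refine ⟨⟨fun a b => ?_⟩, ⟨Quotient.mk _ ⟨0, hr⟩⟩⟩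
    induction a using Quotient.inductionOn with | _ i
    induction b using Quotient.inductionOn with | _ j
    obtain ⟨x, rfl⟩ := hpt i
    obtain ⟨y, rfl⟩ := hpt j
    obtain ⟨g, hg, rfl⟩ := h x y
    refine (apply_eq_of_mem_closure (f := fun x : Point n => Quotient.mk (circleSetoid σ) x.1)
      ?_ hg x).symm
    rintro g (rfl | rfl) z
    · exact (Quotient.sound (Relation.EqvGen.rel _ _ ⟨z, rfl, rfl⟩)).symm
    · rfl
  · rintro ⟨⟨h⟩, -⟩
    have key : ∀ i j, circleSetoid σ i j → ∀ x y : Point n, x.1 = i → y.1 = j →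
        ∃ g ∈ Subgroup.closure {σ, gammaPerm n}, g x = y := by
      intro i j hij
      induction (hij : Relation.EqvGen _ i j) with
      | rel i j hij =>
        obtain ⟨z, rfl, rfl⟩ := hij
        intro x y hx hy
        obtain ⟨k, hk⟩ := gammaPerm_pow_eq hx
        obtain ⟨l, hl⟩ := gammaPerm_pow_eq hy.symm
        exact ⟨_, mul_mem (pow_mem hγ l) (mul_mem hσ (pow_mem hγ k)), by
          rw [Equiv.Perm.mul_apply, Equiv.Perm.mul_apply, hk, hl]⟩
      | refl i =>
        intro x y hx hy
        obtain ⟨k, hk⟩ := gammaPerm_pow_eq (hx.trans hy.symm)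
        exact ⟨_, pow_mem hγ k, hk⟩
      | symm i j h ih =>
        intro x y hx hy
        obtain ⟨g, hg, rfl⟩ := ih y x hy hx
        exact ⟨g⁻¹, inv_mem hg, by simp⟩
      | trans i j k h h' ih ih' =>
        intro x y hx hy
        obtain ⟨z, hz⟩ := hpt j
        obtain ⟨g, hg, rfl⟩ := ih x z hx hz
        obtain ⟨g', hg', rfl⟩ := ih' _ y hz hy
        exact ⟨_, mul_mem hg' hg, rfl⟩
    exact fun x y => key _ _ (Quotient.exact (h _ _)) x y rfl rfl

end Connected

/-! ### The combinatorial Wick formula -/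

section Wick

variable {S I : Type*} [Fintype S] [Fintype I] [DecidableEq I]

/-- A matching exists only if corresponding fibres of `p` and `q` have equal size; all matchings
then differ from a fixed one by a permutation preserving the fibres of `p`. -/
theorem card_matchings [DecidableEq S] (p q : S → I) :
    Nat.card {σ : Equiv.Perm S // ∀ x, p (σ x) = q x} =
      ∏ i, if Fintype.card {x // q x = i} = Fintype.card {x // p x = i} then
        (Fintype.card {x // p x = i}).factorial else 0 := by
  by_cases h : ∀ i, Fintype.card {x // q x = i} = Fintype.card {x // p x = i}
  · simp only [h, if_true]
    let e : ∀ i, {x // q x = i} ≃ {x // p x = i} := fun i => Fintype.equivOfCardEq (h i)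
    let σ₀ : Equiv.Perm S := (Equiv.sigmaFiberEquiv q).symm.trans
      ((Equiv.sigmaCongrRight e).trans (Equiv.sigmaFiberEquiv p))
    have hσ : ∀ x, p (σ₀ x) = q x := fun x => (e (q x) ⟨x, rfl⟩).2
    rw [← DomMulAct.stabilizer_card, ← Nat.card_eq_fintype_card]
    refine Nat.card_congr ⟨fun σ => ⟨σ.1 * σ₀⁻¹, ?_⟩, fun g => ⟨g.1 * σ₀, ?_⟩, ?_, ?_⟩
    · funext x
      rw [Function.comp_apply, Equiv.Perm.mul_apply, σ.2, ← hσ, ← Equiv.Perm.mul_apply,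
        mul_inv_cancel, Equiv.Perm.one_apply]
    · exact fun x => (congrFun g.2 (σ₀ x)).trans (hσ x)
    · exact fun σ => Subtype.ext (inv_mul_cancel_right _ _)
    · exact fun g => Subtype.ext (mul_inv_cancel_right _ _)
  · obtain ⟨i, hi⟩ := not_forall.1 h
    rw [Finset.prod_eq_zero (Finset.mem_univ i) (if_neg hi)]
    have : IsEmpty {σ : Equiv.Perm S // ∀ x, p (σ x) = q x} := ⟨fun σ => hi
      (Fintype.card_congr (σ.1.subtypeEquiv fun x => by rw [σ.2]))⟩
    exact Nat.card_of_isEmpty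

/-- The moments `E[conj(Z)^a Z^b]` of a complex Gaussian variable `Z` of variance `v`. -/
def gaussMoment (v : ℂ) (a b : ℕ) : ℂ := if b = a then a.factorial * v ^ a else 0

theorem prod_gaussMoment [DecidableEq S] (v : ℂ) (p q : S → I) :
    ∏ i, gaussMoment v (Fintype.card {x // p x = i}) (Fintype.card {x // q x = i}) =
      v ^ Fintype.card S * ∑ σ : Equiv.Perm S, if ∀ x, p (σ x) = q x then (1 : ℂ) else 0 := by
  have hS : Fintype.card S = ∑ i, Fintype.card {x // p x = i} := by
    rw [← Fintype.card_sigma, Fintype.card_congr (Equiv.sigmaFiberEquiv p)]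
  have hc : (Finset.univ.filter fun σ : Equiv.Perm S => ∀ x, p (σ x) = q x).card =
      Nat.card {σ : Equiv.Perm S // ∀ x, p (σ x) = q x} := by
    rw [Nat.card_eq_fintype_card, Fintype.card_subtype]
  rw [Finset.sum_boole, hc, card_matchings, hS, ← Finset.prod_pow_eq_pow_sum, Nat.cast_prod,
    ← Finset.prod_mul_distrib]
  refine Finset.prod_congr rfl fun i _ => ?_
  unfold gaussMoment
  split_ifs
  · rw [mul_comm]
  · simp

end Wick

/-! ### Traces of products as sums over indices -/

section Trace

variable {ι R : Type*} [Fintype ι] [CommSemiring R]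

theorem sum_fin_succ {m : ℕ} (F : (Fin (m + 1) → ι) → R) :
    ∑ a, F a = ∑ i, ∑ b : Fin m → ι, F (Fin.cons i b) := by
  rw [← Fintype.sum_prod_type', ← Fintype.sum_equiv (Fin.consEquiv fun _ : Fin (m + 1) => ι)
    (fun p => F (Fin.cons p.1 p.2)) F fun _ => rfl]

variable [DecidableEq ι]

theorem prod_ofFn_apply {m : ℕ} (M : Fin (m + 1) → Matrix ι ι R) (i j : ι) :
    (List.ofFn M).prod i j = ∑ a : Fin m → ι, ∏ k,
      M k ((Fin.cons i a : Fin (m + 1) → ι) k) ((Fin.snoc a j : Fin (m + 1) → ι) k) := by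
  induction m generalizing i with
  | zero => simp [Fin.snoc]
  | succ m ih =>
    rw [List.ofFn_succ, List.prod_cons, Matrix.mul_apply, sum_fin_succ]
    refine Finset.sum_congr rfl fun l _ => ?_
    rw [ih, Finset.mul_sum]
    refine Finset.sum_congr rfl fun a _ => ?_
    rw [← Fin.cons_snoc_eq_snoc_cons]
    conv_rhs => rw [Fin.prod_univ_succ]
    rfl

/-- Closing the index path identifies its two ends. For `m = 0` the left side would be the trace of
the identity, the right side `1`. -/
theorem trace_prod_ofFn {m : ℕ} (hm : 1 ≤ m) (M : Fin m → Matrix ι ι R) :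
    (List.ofFn M).prod.trace = ∑ a : Fin m → ι, ∏ k, M k (a k) (a (finRotate m k)) := by
  obtain ⟨m, rfl⟩ : ∃ k, m = k + 1 := ⟨m - 1, by omega⟩
  rw [sum_fin_succ]
  refine Finset.sum_congr rfl fun i _ => ?_
  rw [Matrix.diag_apply, prod_ofFn_apply]
  refine Finset.sum_congr rfl fun a _ => ?_
  rw [Fin.snoc_eq_cons_rotate]

theorem prod_trace_prod_ofFn {κ : Type*} [Fintype κ] [DecidableEq κ] {m : κ → ℕ}
    (hm : ∀ c, 1 ≤ m c) (M : (Σ c, Fin (m c)) → Matrix ι ι R) :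
    ∏ c, (List.ofFn fun k => M ⟨c, k⟩).prod.trace = ∑ a : (Σ c, Fin (m c)) → ι, ∏ x,
      M x (a x) (a (Equiv.Perm.sigmaCongrRight (fun c => finRotate (m c)) x)) := by
  rw [Finset.prod_congr rfl fun c _ => trace_prod_ofFn (hm c) _, Finset.prod_univ_sum,
    Fintype.piFinset_univ]
  refine (Fintype.sum_equiv (Equiv.piCurry fun _ _ => ι) _ _ fun a => ?_).symm
  rw [Fintype.prod_sigma]
  rfl

end Trace

/-! ### Cycles of a permutation as rotated circles -/

section CycleEquiv

variable {α : Type*} (σ : Equiv.Perm α)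

theorem minimalPeriod_pos [Finite α] (x : α) : 0 < Function.minimalPeriod σ x :=
  Function.minimalPeriod_pos_of_mem_periodicPts (Function.Injective.mem_periodicPts σ.injective x)

theorem pow_mod_minimalPeriod (x : α) (k : ℕ) :
    (σ ^ (k % Function.minimalPeriod σ x)) x = (σ ^ k) x := by
  rw [Equiv.Perm.coe_pow, Equiv.Perm.coe_pow, Function.iterate_mod_minimalPeriod_eq]

/-- The points of the cycles of a permutation, each cycle being read from a chosen point. -/
def cycleEquiv [Finite α] : (Σ c : Cycles σ, Fin (Function.minimalPeriod σ c.out)) ≃ α :=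
  Equiv.ofBijective (fun p => (σ ^ p.2.val) p.1.out) <| by
    constructor
    · rintro ⟨c, k⟩ ⟨c', k'⟩ h
      have h' : (σ ^ k.val) c.out = (σ ^ k'.val) c'.out := h
      have hc : ∀ (c : Cycles σ) (k : ℕ), Quotient.mk (Equiv.Perm.SameCycle.setoid σ)
          ((σ ^ k) c.out) = c := fun c k => by
        conv_rhs => rw [← Quotient.out_eq c]
        exact Quotient.sound (Equiv.Perm.sameCycle_pow_left.2 (Equiv.Perm.SameCycle.refl _ _))
      obtain rfl : c = c' := by rw [← hc c k, h', hc]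
      congr 1
      rw [Equiv.Perm.coe_pow, Equiv.Perm.coe_pow] at h'
      exact Fin.ext (Function.iterate_injOn_Iio_minimalPeriod k.2 k'.2 h')
    · intro x
      have hx : σ.SameCycle (Quotient.mk (Equiv.Perm.SameCycle.setoid σ) x).out x :=
        Quotient.exact (s := Equiv.Perm.SameCycle.setoid σ) (Quotient.out_eq _)
      obtain ⟨k, hk⟩ := hx.exists_nat_pow_eq
      refine ⟨⟨Quotient.mk _ x, ⟨k % Function.minimalPeriod σ _,
        Nat.mod_lt _ (minimalPeriod_pos σ _)⟩⟩, ?_⟩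
      exact (pow_mod_minimalPeriod σ _ k).trans hk

/-- Every permutation is conjugate to a rotation of circles, so the trace expansion over circles
transfers to the cycles of `σ`. -/
theorem cycleEquiv_rotate [Finite α] (p : Σ c : Cycles σ, Fin (Function.minimalPeriod σ c.out)) :
    cycleEquiv σ (Equiv.Perm.sigmaCongrRight (fun _ => finRotate _) p) = σ (cycleEquiv σ p) := by
  obtain ⟨c, k⟩ := p
  change (σ ^ (finRotate _ k).val) c.out = σ ((σ ^ k.val) c.out)
  have hk : (finRotate _ k).val = (k.val + 1) % Function.minimalPeriod σ c.out := by
    revert k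
    generalize hm : Function.minimalPeriod σ c.out = m
    intro k
    obtain ⟨m, rfl⟩ : ∃ l, m = l + 1 := ⟨m - 1, by have := k.2; omega⟩
    rw [finRotate_apply, Fin.val_add, Fin.val_one', Nat.add_mod_mod]
  rw [hk, pow_mod_minimalPeriod, pow_succ', Equiv.Perm.mul_apply]

theorem cycleWord_eq_prod_ofFn {A : Type*} [Monoid A] (a : α → A) (x : α) :
    cycleWord σ a x = (List.ofFn fun k : Fin (Function.minimalPeriod σ x) =>
      a ((σ ^ k.val) x)).prod := by
  rw [cycleWord, List.ofFn_eq_map, ← List.map_coe_finRange_eq_range, List.map_map]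
  rfl

/-- The product of the traces around the cycles of a permutation, as a sum over indices. -/
theorem prod_trace_cycleWord [Fintype α] [DecidableEq α] [Fintype (Cycles σ)] {ι R : Type*}
    [Fintype ι] [DecidableEq ι] [CommSemiring R] (D : α → Matrix ι ι R) :
    ∏ c : Cycles σ, (cycleWord σ D c.out).trace = ∑ b : α → ι, ∏ x, D x (b x) (b (σ x)) := by
  classical
  simp only [cycleWord_eq_prod_ofFn]
  refine (prod_trace_prod_ofFn (fun c => minimalPeriod_pos σ _)
    (fun p => D (cycleEquiv σ p))).trans ?_
  refine (Fintype.sum_equiv ((cycleEquiv σ).symm.arrowCongr (Equiv.refl ι)) _ _ fun b => ?_).symm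
  refine (Fintype.prod_equiv (cycleEquiv σ) _ _ fun p => ?_).symm
  exact congrArg (fun y => D (cycleEquiv σ p) (b (cycleEquiv σ p)) (b y))
    (cycleEquiv_rotate σ p)

end CycleEquiv

/-- The trace of a product of compound Wishart matrices, over several circles, with possibly
different Gaussian matrices for the different circles. -/
theorem prod_wishartTrace {r : ℕ} {n : Fin r → ℕ} (hn : ∀ j, 1 ≤ n j) {N : ℕ}
    (X : Fin r → Matrix (Fin N) (Fin N) ℂ) (D : Point n → Matrix (Fin N) (Fin N) ℂ) :
    ∏ j, wishartTrace n (X j) D j =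
      ∑ a : Point n → Fin N, ∑ b : Point n → Fin N, ∑ c : Point n → Fin N,
        (∏ x, D x (b x) (c x)) *
          ∏ x, (starRingEnd ℂ (X x.1 (b x) (a x)) * X x.1 (c x) (a (gammaPerm n x))) := by
  unfold wishartTrace
  rw [prod_trace_prod_ofFn hn (fun x => wishart (X x.1) (D x))]
  refine Finset.sum_congr rfl fun a _ => ?_
  have : ∀ x : Point n, wishart (X x.1) (D x) (a x) (a (gammaPerm n x)) =
      ∑ p : Fin N × Fin N, D x p.1 p.2 *
        (starRingEnd ℂ (X x.1 p.1 (a x)) * X x.1 p.2 (a (gammaPerm n x))) := fun x => by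
    rw [wishart, Matrix.mul_apply, Fintype.sum_prod_type_right]
    refine Finset.sum_congr rfl fun c _ => ?_
    rw [Matrix.mul_apply, Finset.sum_mul]
    refine Finset.sum_congr rfl fun b _ => ?_
    rw [Matrix.conjTranspose_apply]
    simp only [Complex.star_def]
    ring
  change ∏ x : Point n, wishart (X x.1) (D x) (a x) (a (gammaPerm n x)) = _
  rw [Finset.prod_congr rfl fun x _ => this x, Finset.prod_univ_sum, Fintype.piFinset_univ,
    ← Fintype.sum_prod_type']
  refine Fintype.sum_equiv (Equiv.arrowProdEquivProdArrow _ _ _) _ _ fun p => ?_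
  rw [Finset.prod_mul_distrib]
  rfl

/-! ### Random variables with all moments -/

/-- The random variable `f` has finite absolute moments of every order. -/
def HasAllMoments {Ω : Type*} [MeasurableSpace Ω] (μ : Measure Ω) (f : Ω → ℂ) : Prop :=
  ∀ p : NNReal, MemLp f p μ

namespace HasAllMoments

variable {Ω : Type*} [MeasurableSpace Ω] {μ : Measure Ω} {f g : Ω → ℂ}

theorem integrable (hf : HasAllMoments μ f) : Integrable f μ :=
  memLp_one_iff_integrable.1 (by simpa using hf 1)

theorem const [IsFiniteMeasure μ] (c : ℂ) : HasAllMoments μ fun _ => c := fun _ => memLp_const c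

theorem conj (hf : HasAllMoments μ f) : HasAllMoments μ fun ω => starRingEnd ℂ (f ω) :=
  fun p => (hf p).star

/-- By Hölder, a product is in `L^p` when both factors are in `L^{2p}`; asking for all exponents
makes the class closed under products. -/
theorem mul (hf : HasAllMoments μ f) (hg : HasAllMoments μ g) :
    HasAllMoments μ fun ω => f ω * g ω := fun p => by
  have : ENNReal.HolderTriple (2 * p : NNReal) (2 * p : NNReal) p := ⟨by
    rcases eq_or_ne p 0 with rfl | hp
    · simp
    · rw [← ENNReal.coe_inv (by positivity), ← ENNReal.coe_inv hp, ← ENNReal.coe_add,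
        ENNReal.coe_inj]
      field_simp
      norm_num⟩
  exact (hg (2 * p)).mul' (hf (2 * p))

theorem sum {ι : Type*} (s : Finset ι) {f : ι → Ω → ℂ} (hf : ∀ i ∈ s, HasAllMoments μ (f i)) :
    HasAllMoments μ fun ω => ∑ i ∈ s, f i ω := fun p =>
  memLp_finsetSum s fun i hi => hf i hi p

theorem prod [IsFiniteMeasure μ] {ι : Type*} (s : Finset ι) {f : ι → Ω → ℂ}
    (hf : ∀ i ∈ s, HasAllMoments μ (f i)) : HasAllMoments μ fun ω => ∏ i ∈ s, f i ω := by
  classical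
  induction s using Finset.induction_on with
  | empty => simpa using const (μ := μ) 1
  | insert i s hi ih =>
    simp only [Finset.prod_insert hi]
    exact (hf i (Finset.mem_insert_self i s)).mul
      (ih fun j hj => hf j (Finset.mem_insert_of_mem hj))

theorem matrixMul {N : ℕ} {M M' : Ω → Matrix (Fin N) (Fin N) ℂ}
    (h : ∀ i j, HasAllMoments μ fun ω => M ω i j) (h' : ∀ i j, HasAllMoments μ fun ω => M' ω i j)
    (i j : Fin N) : HasAllMoments μ fun ω => (M ω * M' ω) i j := by
  simp only [Matrix.mul_apply]
  exact sum _ fun k _ => (h i k).mul (h' k j)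

theorem matrixProd [IsFiniteMeasure μ] {N : ℕ} (L : List (Ω → Matrix (Fin N) (Fin N) ℂ))
    (h : ∀ M ∈ L, ∀ i j, HasAllMoments μ fun ω => M ω i j) (i j : Fin N) :
    HasAllMoments μ fun ω => (L.map fun M => M ω).prod i j := by
  induction L generalizing i j with
  | nil => exact const _
  | cons M L ih =>
    simp only [List.map_cons, List.prod_cons]
    exact matrixMul (h M (by simp)) (fun i j => ih (fun M' hM' => h M' (by simp [hM'])) i j) i j

end HasAllMoments

/-! ### Moments of complex Gaussian variables -/

theorem hasAllMoments_id_complexGaussian (v : NNReal) :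
    HasAllMoments (complexGaussian v) id := fun p => by
  have hm : Measurable fun p : ℝ × ℝ => (⟨p.1, p.2⟩ : ℂ) :=
    Complex.measurableEquivRealProd.symm.measurable
  rw [complexGaussian, memLp_map_measure_iff aestronglyMeasurable_id hm.aemeasurable]
  have h1 : MemLp (fun x : ℝ × ℝ => (x.1 : ℂ)) p
      ((gaussianReal 0 (v / 2)).prod (gaussianReal 0 (v / 2))) :=
    ((memLp_id_gaussianReal p).comp_measurePreserving measurePreserving_fst).ofReal
  have h2 : MemLp (fun x : ℝ × ℝ => (x.2 : ℂ)) p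
      ((gaussianReal 0 (v / 2)).prod (gaussianReal 0 (v / 2))) :=
    ((memLp_id_gaussianReal p).comp_measurePreserving measurePreserving_snd).ofReal
  convert h1.add (h2.mul_const Complex.I) using 1
  funext x
  apply Complex.ext <;> simp

theorem integral_complexGaussian {v : NNReal} (hv : v ≠ 0) (f : ℂ → ℂ) :
    ∫ z, f z ∂complexGaussian v =
      ∫ z, (((Real.pi * v)⁻¹ * Real.exp (-(v : ℝ)⁻¹ * ‖z‖ ^ 2) : ℝ) : ℂ) * f z := by
  have hv2 : v / 2 ≠ 0 := by positivity
  have hv' : (v : ℝ) ≠ 0 := by exact_mod_cast hv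
  rw [complexGaussian, gaussianReal_of_var_ne_zero _ hv2,
    prod_withDensity (measurable_gaussianPDF _ _) (measurable_gaussianPDF _ _)]
  change ∫ z, f z ∂(Measure.map Complex.measurableEquivRealProd.symm _) = _
  rw [integral_map_equiv, integral_withDensity_eq_integral_toReal_smul,
    ← (Complex.volume_preserving_equiv_real_prod.symm).integral_comp
      Complex.measurableEquivRealProd.symm.measurableEmbedding]
  · refine integral_congr_ae (Eventually.of_forall fun p => ?_)
    simp only [Complex.real_smul]
    congr 2
    rw [ENNReal.toReal_mul, toReal_gaussianPDF, toReal_gaussianPDF, gaussianPDFReal,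
      gaussianPDFReal, mul_mul_mul_comm, ← Real.exp_add, ← mul_inv,
      Real.mul_self_sqrt (by positivity)]
    congr 1
    · push_cast; field_simp
    · congr 1
      rw [← Complex.normSq_eq_norm_sq, Complex.normSq_apply]
      simp only [Complex.measurableEquivRealProd_symm_apply]
      push_cast
      field_simp
      ring
  · exact ((measurable_gaussianPDF _ _).comp measurable_fst).mul
      ((measurable_gaussianPDF _ _).comp measurable_snd)
  · exact Eventually.of_forall fun p => ENNReal.mul_lt_top gaussianPDF_lt_top gaussianPDF_lt_top

theorem integral_conj_pow_mul_pow_of_ne {v : NNReal} (hv : v ≠ 0) {a b : ℕ} (hab : b ≠ a) :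
    ∫ z, starRingEnd ℂ z ^ a * z ^ b ∂complexGaussian v = 0 := by
  have hd : ((b : ℝ) - a) ≠ 0 := sub_ne_zero.2 (by exact_mod_cast hab)
  -- The angle is chosen so that rotation by `w` multiplies the integrand by `w ^ (b - a) = -1`;
  -- rotation invariance then makes the integral its own negative.
  let w : Circle := Circle.exp (Real.pi / ((b : ℝ) - a))
  have hw : starRingEnd ℂ (w : ℂ) ^ a * (w : ℂ) ^ b = -1 := by
    have hd' : ((b : ℂ) - a) ≠ 0 := by exact_mod_cast hd
    rw [Circle.coe_exp, ← Complex.exp_conj, ← Complex.exp_nat_mul, ← Complex.exp_nat_mul,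
      ← Complex.exp_add, ← Complex.exp_pi_mul_I]
    congr 1
    simp only [map_mul, Complex.conj_ofReal, Complex.conj_I]
    push_cast
    field_simp
    ring
  rw [integral_complexGaussian hv]
  set F : ℂ → ℂ := fun z => (((Real.pi * v)⁻¹ * Real.exp (-(v : ℝ)⁻¹ * ‖z‖ ^ 2) : ℝ) : ℂ) *
    (starRingEnd ℂ z ^ a * z ^ b) with hF
  have h1 : ∫ z, F (rotation w z) = ∫ z, F z :=
    (rotation w).measurePreserving.integral_comp
      (rotation w).toHomeomorph.toMeasurableEquiv.measurableEmbedding F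
  have h2 : ∀ z, F (rotation w z) = - F z := fun z => by
    simp only [hF, rotation_apply, norm_mul, Circle.norm_coe, one_mul, map_mul, mul_pow]
    linear_combination (((Real.pi * v)⁻¹ * Real.exp (-(v : ℝ)⁻¹ * ‖z‖ ^ 2) : ℝ) : ℂ) *
      (starRingEnd ℂ z ^ a * z ^ b) * hw
  simp only [h2, integral_neg] at h1
  exact self_eq_neg.1 h1.symm

theorem integral_conj_pow_mul_pow_self {v : NNReal} (hv : v ≠ 0) (a : ℕ) :
    ∫ z, starRingEnd ℂ z ^ a * z ^ a ∂complexGaussian v = a.factorial * (v : ℂ) ^ a := by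
  have hv' : 0 < (v : ℝ) := by exact_mod_cast hv.bot_lt
  have h := Complex.integral_rpow_mul_exp_neg_mul_rpow (p := 2) (q := 2 * a) one_le_two
    (by have : (0 : ℝ) ≤ a := Nat.cast_nonneg a; linarith) (inv_pos.2 hv')
  have h3 : (-((2 : ℝ) * a + 2) / 2) = -((a + 1 : ℕ) : ℝ) := by push_cast; ring
  have h4 : ((2 : ℝ) * a + 2) / 2 = a + 1 := by ring
  rw [h3, h4, Real.Gamma_nat_eq_factorial, Real.rpow_neg (inv_pos.2 hv').le, Real.rpow_natCast] at h
  rw [integral_complexGaussian hv]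
  have h1 : ∀ z : ℂ, (((Real.pi * v)⁻¹ * Real.exp (-(v : ℝ)⁻¹ * ‖z‖ ^ 2) : ℝ) : ℂ) *
      (starRingEnd ℂ z ^ a * z ^ a) =
      (((Real.pi * v)⁻¹ *
        (‖z‖ ^ (2 * (a : ℝ)) * Real.exp (-(v : ℝ)⁻¹ * ‖z‖ ^ (2 : ℝ))) : ℝ) : ℂ) := by
    intro z
    rw [← mul_pow, ← Complex.normSq_eq_conj_mul_self, Complex.normSq_eq_norm_sq,
      Real.rpow_mul (norm_nonneg z), Real.rpow_natCast, Real.rpow_two]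
    push_cast
    ring
  simp only [h1]
  rw [integral_complex_ofReal, integral_const_mul, h]
  norm_cast
  have := Real.pi_pos
  rw [inv_pow, inv_inv]
  field_simp
  push_cast
  ring

theorem integral_conj_pow_mul_pow {v : NNReal} (hv : v ≠ 0) (a b : ℕ) :
    ∫ z, starRingEnd ℂ z ^ a * z ^ b ∂complexGaussian v = gaussMoment v a b := by
  unfold gaussMoment
  split_ifs with h
  · subst h
    exact integral_conj_pow_mul_pow_self hv b
  · exact integral_conj_pow_mul_pow_of_ne hv h

/-! ### Moments of complex Gaussian matrices -/

section Matrix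

variable {Ω : Type*} [MeasurableSpace Ω] {μ : Measure Ω} {N : ℕ}
  {X : Ω → Matrix (Fin N) (Fin N) ℂ}

theorem IsComplexGaussianMatrix.hasAllMoments (hX : IsComplexGaussianMatrix μ X) (i j : Fin N) :
    HasAllMoments μ fun ω => X ω i j := fun p => by
  have h := hasAllMoments_id_complexGaussian (N : NNReal)⁻¹ p
  rw [← (hX.hasLaw i j).map_eq, memLp_map_measure_iff aestronglyMeasurable_id
    (hX.hasLaw i j).aemeasurable] at h
  exact h

theorem hasAllMoments_wishartTrace [IsProbabilityMeasure μ] (hX : IsComplexGaussianMatrix μ X) {r : ℕ}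
    (n : Fin r → ℕ)
    (D : Point n → Matrix (Fin N) (Fin N) ℂ) (j : Fin r) :
    HasAllMoments μ fun ω => wishartTrace n (X ω) D j := by
  change HasAllMoments μ fun ω => ∑ i : Fin N,
    (List.ofFn fun k : Fin (n j) => wishart (X ω) (D ⟨j, k⟩)).prod i i
  refine HasAllMoments.sum _ fun i _ => ?_
  have hw : ∀ D : Matrix (Fin N) (Fin N) ℂ, ∀ i j, HasAllMoments μ fun ω => wishart (X ω) D i j :=
    fun D => HasAllMoments.matrixMul (HasAllMoments.matrixMul
      (fun i j => (hX.hasAllMoments j i).conj) fun _ _ => HasAllMoments.const _) hX.hasAllMoments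
  have := HasAllMoments.matrixProd
    (List.ofFn fun (k : Fin (n j)) (ω : Ω) => wishart (X ω) (D ⟨j, k⟩)) (μ := μ) (by
      intro M hM
      obtain ⟨k, rfl⟩ := (List.mem_ofFn' _ _).1 hM
      exact hw _) i i
  simpa only [List.map_ofFn] using! this

theorem hasAllMoments_monomial [IsProbabilityMeasure μ] (hX : IsComplexGaussianMatrix μ X)
    {S : Type*} (T : Finset S)
    (p q : S → Fin N × Fin N) : HasAllMoments μ fun ω =>
      ∏ x ∈ T, (starRingEnd ℂ (X ω (p x).1 (p x).2) * X ω (q x).1 (q x).2) :=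
  HasAllMoments.prod _ fun _ _ => (hX.hasAllMoments _ _).conj.mul (hX.hasAllMoments _ _)

/-- Grouping the factors by matrix entry, independence reduces the expectation to moments of single
entries. -/
theorem integral_monomial (hX : IsComplexGaussianMatrix μ X) (hN : N ≠ 0) {S : Type*}
    (T : Finset S) (p q : S → Fin N × Fin N) :
    ∫ ω, ∏ x ∈ T, (starRingEnd ℂ (X ω (p x).1 (p x).2) * X ω (q x).1 (q x).2) ∂μ =
      ∏ i, gaussMoment (N : ℂ)⁻¹ (T.filter fun x => p x = i).card
        (T.filter fun x => q x = i).card := by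
  have hv : (N : NNReal)⁻¹ ≠ 0 := by simpa using hN
  have hm : ∀ a b : ℕ, Continuous fun z : ℂ => starRingEnd ℂ z ^ a * z ^ b := fun a b => by fun_prop
  have h1 : ∀ ω, ∏ x ∈ T, (starRingEnd ℂ (X ω (p x).1 (p x).2) * X ω (q x).1 (q x).2) =
      ∏ i : Fin N × Fin N, (starRingEnd ℂ (X ω i.1 i.2) ^ (T.filter fun x => p x = i).card *
        X ω i.1 i.2 ^ (T.filter fun x => q x = i).card) := fun ω => by
    rw [Finset.prod_mul_distrib, Finset.prod_mul_distrib]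
    congr 1
    · rw [← Finset.prod_fiberwise T p]
      refine Finset.prod_congr rfl fun i _ => Finset.prod_eq_pow_card fun x hx => ?_
      rw [(Finset.mem_filter.1 hx).2]
    · rw [← Finset.prod_fiberwise T q]
      refine Finset.prod_congr rfl fun i _ => Finset.prod_eq_pow_card fun x hx => ?_
      rw [(Finset.mem_filter.1 hx).2]
  simp only [h1]
  rw [hX.indep.integral_fun_prod_comp (fun i => (hX.hasLaw i.1 i.2).aemeasurable)
    (f := fun i z => starRingEnd ℂ z ^ (T.filter fun x => p x = i).card *
        z ^ (T.filter fun x => q x = i).card) (fun i => (hm _ _).aestronglyMeasurable)]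
  refine Finset.prod_congr rfl fun i _ => ?_
  have := (hX.hasLaw i.1 i.2).integral_comp (hm (T.filter fun x => p x = i).card
    (T.filter fun x => q x = i).card).aestronglyMeasurable
  refine this.trans ?_
  rw [integral_conj_pow_mul_pow hv]
  simp

end Matrix

/-! ### The genus expansion -/

section Genus

variable {r : ℕ} {n : Fin r → ℕ}

/-- The contribution of a permutation to the mixed moments of traces of compound Wishart
matrices. -/
def genusWeight {N : ℕ} (D : Point n → Matrix (Fin N) (Fin N) ℂ) (σ : Equiv.Perm (Point n)) : ℂ :=
  (N : ℂ)⁻¹ ^ Fintype.card (Point n) *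
    ((N : ℂ) ^ numCycles (gammaPerm n * σ⁻¹) * ∑ b : Point n → Fin N, ∏ x, D x (b x) (b (σ x)))

theorem sum_indicator_gamma (N : ℕ) (σ : Equiv.Perm (Point n)) :
    (∑ a : Point n → Fin N, if ∀ x, a (σ x) = a (gammaPerm n x) then (1 : ℂ) else 0) =
      (N : ℂ) ^ numCycles (gammaPerm n * σ⁻¹) := by
  have h : ∀ a : Point n → Fin N, (∀ x, a (σ x) = a (gammaPerm n x)) ↔
      ∀ x, a ((gammaPerm n * σ⁻¹) x) = a x := fun a => by
    constructor
    · intro h x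
      have := h (σ⁻¹ x)
      rw [← Equiv.Perm.mul_apply, mul_inv_cancel] at this
      exact this.symm
    · intro h x
      have := h (σ x)
      rw [← Equiv.Perm.mul_apply, inv_mul_cancel_right] at this
      exact this.symm
  rw [← Nat.cast_pow, ← card_invariant, Nat.card_eq_fintype_card, Finset.sum_boole,
    Fintype.card_subtype]
  simp only [h]

/-- The cumulant in terms of the blocks of partitions. -/
theorem cumulant_eq_sum_block {Ω : Type*} [MeasurableSpace Ω] {μ : Measure Ω}
    (Y : Fin r → Ω → ℂ) : cumulant μ Y =
    ∑ P : Finpartition (Finset.univ : Finset (Fin r)),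
      (-1 : ℂ) ^ (P.parts.card - 1) * ((P.parts.card - 1).factorial : ℂ) *
        ∏ k : P.parts, ∫ ω, ∏ j with block P j = k, Y j ω ∂μ := by
  refine Finset.sum_congr rfl fun P _ => ?_
  congr 1
  rw [← Finset.prod_coe_sort]
  refine Finset.prod_congr rfl fun k _ => ?_
  have : (Finset.univ.filter fun j => block P j = k) = k.1 := by
    ext j
    simp [block_eq_iff_mem]
  rw [this]

variable {Ω : Type*} [MeasurableSpace Ω] {μ : Measure Ω} [IsProbabilityMeasure μ]
  {K : Type*} [Fintype K] [DecidableEq K] (col : Fin r → K)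

/-- Independent copies of the probability space, one for each colour. -/
theorem prod_integral_eq_integral_pi {S : Type*} [Fintype S] (col : S → K) (Y : S → Ω → ℂ) :
    ∏ c, ∫ ω, ∏ j with col j = c, Y j ω ∂μ =
      ∫ ω, ∏ j, Y j (ω (col j)) ∂(Measure.pi fun _ : K => μ) := by
  rw [← integral_fintype_prod_eq_prod fun c ω => ∏ j with col j = c, Y j ω]
  refine integral_congr_ae (Eventually.of_forall fun ω => ?_)
  change ∏ c, ∏ j with col j = c, Y j (ω c) = ∏ j, Y j (ω (col j))
  rw [← Finset.prod_fiberwise Finset.univ col]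
  refine Finset.prod_congr rfl fun c _ => Finset.prod_congr rfl fun j hj => ?_
  rw [(Finset.mem_filter.1 hj).2]

variable {N : ℕ} {X : Ω → Matrix (Fin N) (Fin N) ℂ}

/-- The Wick formula for independent complex Gaussian matrices indexed by colours. -/
theorem integral_pi_monomial (hX : IsComplexGaussianMatrix μ X) (hN : N ≠ 0)
    (a b c : Point n → Fin N) :
    ∫ ω, ∏ x : Point n, (starRingEnd ℂ (X (ω (col x.1)) (b x) (a x)) *
      X (ω (col x.1)) (c x) (a (gammaPerm n x))) ∂(Measure.pi fun _ : K => μ) =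
    (N : ℂ)⁻¹ ^ Fintype.card (Point n) * ∑ σ : Equiv.Perm (Point n),
      if (∀ x, col (σ x).1 = col x.1) ∧ (∀ x, b (σ x) = c x) ∧
        ∀ x, a (σ x) = a (gammaPerm n x) then (1 : ℂ) else 0 := by
  -- The colour acts as a third index of the Gaussian variable, so the Wick pairings respect colours
  -- automatically.
  have h := prod_gaussMoment (N : ℂ)⁻¹ (fun x : Point n => (col x.1, b x, a x))
    (fun x => (col x.1, c x, a (gammaPerm n x)))
  simp only [Prod.mk.injEq, forall_and] at h
  rw [← h, Fintype.prod_prod_type]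
  refine (prod_integral_eq_integral_pi (μ := μ) (fun x : Point n => col x.1) (fun x ω =>
    starRingEnd ℂ (X ω (b x) (a x)) * X ω (c x) (a (gammaPerm n x)))).symm.trans ?_
  refine Finset.prod_congr rfl fun k _ => ?_
  refine (integral_monomial hX hN _ (fun x => (b x, a x))
    (fun x => (c x, a (gammaPerm n x)))).trans ?_
  refine Finset.prod_congr rfl fun i _ => ?_
  rw [Finset.filter_filter, Finset.filter_filter, Fintype.card_subtype, Fintype.card_subtype]
  simp only [Prod.ext_iff]

theorem integrable_pi_monomial (hX : IsComplexGaussianMatrix μ X) (a b c : Point n → Fin N) :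
    Integrable (fun ω : K → Ω => ∏ x : Point n, (starRingEnd ℂ (X (ω (col x.1)) (b x) (a x)) *
      X (ω (col x.1)) (c x) (a (gammaPerm n x)))) (Measure.pi fun _ : K => μ) := by
  have h := Integrable.fintype_prod (μ := fun _ : K => μ) (f := fun k ω =>
    ∏ x : Point n with col x.1 = k, (starRingEnd ℂ (X ω (b x) (a x)) *
      X ω (c x) (a (gammaPerm n x)))) fun k =>
        (hasAllMoments_monomial hX _ (fun x => (b x, a x))
          (fun x => (c x, a (gammaPerm n x)))).integrable
  refine h.congr (Eventually.of_forall fun ω => ?_)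
  refine Eq.trans ?_ (Finset.prod_fiberwise Finset.univ (fun x : Point n => col x.1) _)
  refine Finset.prod_congr rfl fun k _ => Finset.prod_congr rfl fun x hx => ?_
  rw [(Finset.mem_filter.1 hx).2]

theorem prod_integral_wishartTrace (hX : IsComplexGaussianMatrix μ X) (hN : N ≠ 0)
    (hn : ∀ j, 1 ≤ n j) (D : Point n → Matrix (Fin N) (Fin N) ℂ) :
    ∏ k, ∫ ω, ∏ j with col j = k, wishartTrace n (X ω) D j ∂μ =
      ∑ σ : Equiv.Perm (Point n), if ∀ x, col (σ x).1 = col x.1 then genusWeight D σ else 0 := by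
  rw [prod_integral_eq_integral_pi]
  simp only [fun ω : K → Ω => prod_wishartTrace hn (fun j => X (ω (col j))) D]
  have hint := fun a b c => (integrable_pi_monomial col hX a b c).const_mul (∏ x, D x (b x) (c x))
  rw [integral_finsetSum _ fun a _ => integrable_finsetSum _ fun b _ =>
    integrable_finsetSum _ fun c _ => hint a b c]
  simp only [fun a => integral_finsetSum Finset.univ fun b _ =>
    integrable_finsetSum Finset.univ fun c _ => hint a b c,
    fun a b => integral_finsetSum Finset.univ fun c _ => hint a b c, integral_const_mul,
    integral_pi_monomial col hX hN]
  -- The pairing forces `c = b ∘ σ`, which collapses the sum over `c`.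
  have hD : ∀ (σ : Equiv.Perm (Point n)) (b : Point n → Fin N),
      (∑ c : Point n → Fin N, (∏ x, D x (b x) (c x)) * if ∀ x, b (σ x) = c x then (1 : ℂ) else 0) =
        ∏ x, D x (b x) (b (σ x)) := fun σ b => by
    rw [Finset.sum_eq_single (fun x => b (σ x))]
    · simp
    · intro c _ hc
      rw [if_neg (fun h => hc (funext fun x => (h x).symm)), mul_zero]
    · simp
  calc _ = ∑ a : Point n → Fin N, ∑ b : Point n → Fin N, ∑ c : Point n → Fin N,
        ∑ σ : Equiv.Perm (Point n), (if ∀ x, col (σ x).1 = col x.1 then (1 : ℂ) else 0) *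
          ((N : ℂ)⁻¹ ^ Fintype.card (Point n) *
          ((if ∀ x, a (σ x) = a (gammaPerm n x) then (1 : ℂ) else 0) *
          ((∏ x, D x (b x) (c x)) * if ∀ x, b (σ x) = c x then (1 : ℂ) else 0))) := by
        refine Finset.sum_congr rfl fun a _ => Finset.sum_congr rfl fun b _ =>
          Finset.sum_congr rfl fun c _ => ?_
        rw [Finset.mul_sum, Finset.mul_sum]
        refine Finset.sum_congr rfl fun σ _ => ?_
        simp only [ite_and]
        split_ifs <;> ring
    _ = ∑ σ : Equiv.Perm (Point n), ∑ a : Point n → Fin N, ∑ b : Point n → Fin N,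
        ∑ c : Point n → Fin N, (if ∀ x, col (σ x).1 = col x.1 then (1 : ℂ) else 0) *
          ((N : ℂ)⁻¹ ^ Fintype.card (Point n) *
          ((if ∀ x, a (σ x) = a (gammaPerm n x) then (1 : ℂ) else 0) *
          ((∏ x, D x (b x) (c x)) * if ∀ x, b (σ x) = c x then (1 : ℂ) else 0))) := by
        symm
        rw [Finset.sum_comm]
        refine Finset.sum_congr rfl fun a _ => ?_
        rw [Finset.sum_comm]
        refine Finset.sum_congr rfl fun b _ => ?_
        rw [Finset.sum_comm]
    _ = _ := by
        refine Finset.sum_congr rfl fun σ _ => ?_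
        simp only [← Finset.mul_sum, hD, ← Finset.sum_mul, sum_indicator_gamma]
        rw [genusWeight, ite_mul, one_mul, zero_mul]

open Classical in
/-- Only the permutations that connect all circles contribute to the cumulant. -/
theorem cumulant_wishartTrace (hX : IsComplexGaussianMatrix μ X) (hN : N ≠ 0) (hr : 1 ≤ r)
    (hn : ∀ j, 1 ≤ n j) (D : Point n → Matrix (Fin N) (Fin N) ℂ) :
    cumulant μ (fun j ω => wishartTrace n (X ω) D j) =
      ∑ σ : Equiv.Perm (Point n),
        if ∀ x y : Point n, ∃ g ∈ Subgroup.closure {σ, gammaPerm n}, g x = y then genusWeight D σ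
        else 0 := by
  have : Nonempty (Fin r) := ⟨⟨0, hr⟩⟩
  rw [cumulant_eq_sum_block]
  simp only [fun P : Finpartition (Finset.univ : Finset (Fin r)) =>
    prod_integral_wishartTrace (block P) hX hN hn D, Finset.mul_sum]
  rw [Finset.sum_comm]
  refine Finset.sum_congr rfl fun σ _ => ?_
  -- After exchanging the sums, the coefficient of `σ` is the total Möbius weight of the partitions
  -- coarser than `circleSetoid σ`.
  have h := congrArg (Int.cast : ℤ → ℂ) (sum_moebius (circleSetoid σ))
  push_cast at h
  simp only [transitive_iff hr hn]
  rw [← mul_boole, ← h, Finset.mul_sum, Finset.sum_filter]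
  refine Finset.sum_congr rfl fun P _ => ?_
  simp only [circleSetoid_le_iff]
  split_ifs
  · ring
  · simp

/-! ### The limit -/

theorem le_numCycles_gammaPerm (hn : ∀ j, 1 ≤ n j) : r ≤ numCycles (gammaPerm n) := by
  have hs : Function.Surjective (Quotient.lift (s := Equiv.Perm.SameCycle.setoid (gammaPerm n))
      (fun x : Point n => x.1) fun _ _ h => eq_of_sameCycle gammaPerm_fst h) :=
    fun j => ⟨Quotient.mk _ ⟨j, ⟨0, hn j⟩⟩, rfl⟩
  have h := Nat.card_le_card_of_surjective _ hs
  rwa [Nat.card_fin] at h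

theorem tendsto_natCast_zpow {e : ℤ} (he : e ≤ 0) :
    Tendsto (fun N : ℕ => (N : ℂ) ^ e) atTop (𝓝 (if e = 0 then 1 else 0)) := by
  obtain ⟨k, rfl⟩ : ∃ k : ℕ, e = -k := ⟨(-e).toNat, by omega⟩
  simp only [zpow_neg, zpow_natCast, ← inv_pow]
  have := (tendsto_inv_atTop_nhds_zero_nat (𝕜 := ℂ)).pow k
  rcases eq_or_ne k 0 with rfl | hk
  · simp
  · rw [zero_pow hk] at this
    simpa [hk] using this

theorem tendsto_normTrace_cycleWord {A : Type*} [Ring A] [Algebra ℂ A]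
    {D : Point n → (N : ℕ) → Matrix (Fin N) (Fin N) ℂ} {ψ : A →ₗ[ℂ] ℂ} {d : Point n → A}
    (hD : ConvergesInDistribution D ψ d) (σ : Equiv.Perm (Point n)) (x : Point n) :
    Tendsto (fun N => normTrace (cycleWord σ (fun y => D y N) x)) atTop
      (𝓝 (ψ (cycleWord σ d x))) := by
  have := hD ((List.range (Function.minimalPeriod σ x)).map fun k => (σ ^ k) x)
  simpa only [List.map_map] using! this

theorem tendsto_genusWeight (hn : ∀ j, 1 ≤ n j) {A : Type*} [Ring A] [Algebra ℂ A]
    {D : Point n → (N : ℕ) → Matrix (Fin N) (Fin N) ℂ} {ψ : A →ₗ[ℂ] ℂ} {d : Point n → A}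
    (hD : ConvergesInDistribution D ψ d) (σ : Equiv.Perm (Point n))
    (hσ : ∀ x y : Point n, ∃ g ∈ Subgroup.closure {σ, gammaPerm n}, g x = y) :
    Tendsto (fun N : ℕ => (N : ℂ) ^ ((r : ℤ) - 2) * genusWeight (fun x => D x N) σ) atTop
      (𝓝 (if numCycles σ + numCycles (gammaPerm n * σ⁻¹) + r = (∑ j, n j) + 2 then
        psiPerm (fun a => ψ a) σ d else 0)) := by
  let _ := Fintype.ofFinite (Cycles σ)
  have hcard : Fintype.card (Point n) = ∑ j, n j := by simp
  have hg := numCycles_add_le σ (gammaPerm n) hσ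
  rw [Nat.card_eq_fintype_card, hcard] at hg
  have hr := le_numCycles_gammaPerm hn
  -- The term `-n` comes from the variances, `#(γσ⁻¹)` from the free indices `a`, and `#σ` from
  -- normalizing the traces. The genus inequality with `r ≤ #γ` gives `e ≤ 0`.
  set e : ℤ := (r : ℤ) - 2 - (∑ j, n j : ℕ) + numCycles (gammaPerm n * σ⁻¹) + numCycles σ with he
  have h1 := (tendsto_natCast_zpow (e := e) (by omega)).mul
    (tendsto_finsetProd Finset.univ fun (c : Cycles σ) _ => tendsto_normTrace_cycleWord hD σ c.out)
  have h2 : (if e = 0 then (1 : ℂ) else 0) * ∏ c : Cycles σ, ψ (cycleWord σ d c.out) =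
      if numCycles σ + numCycles (gammaPerm n * σ⁻¹) + r = (∑ j, n j) + 2 then
        psiPerm (fun a => ψ a) σ d else 0 := by
    rw [ite_mul, one_mul, zero_mul]
    exact if_congr (by omega) rfl rfl
  rw [h2] at h1
  refine h1.congr' ?_
  filter_upwards [eventually_ne_atTop 0] with N hN
  have hN' : (N : ℂ) ≠ 0 := by exact_mod_cast hN
  have hc : numCycles σ = Fintype.card (Cycles σ) := Nat.card_eq_fintype_card
  have h3 : ∑ b : Point n → Fin N, ∏ x, D x N (b x) (b (σ x)) = (N : ℂ) ^ numCycles σ *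
      ∏ c : Cycles σ, normTrace (cycleWord σ (fun y => D y N) c.out) := by
    rw [← prod_trace_cycleWord σ fun x => D x N, hc, ← Finset.card_univ, ← Finset.prod_const,
      ← Finset.prod_mul_distrib]
    refine Finset.prod_congr rfl fun c _ => ?_
    rw [normTrace, mul_inv_cancel_left₀ hN']
  rw [genusWeight, h3, hcard, he, zpow_add₀ hN', zpow_add₀ hN',
    sub_eq_add_neg _ ((∑ j, n j : ℕ) : ℤ),
    zpow_add₀ hN', zpow_neg, zpow_natCast, zpow_natCast, zpow_natCast, inv_pow]
  ring

end Genus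

end CompoundWishart
end

open CompoundWishart in
theorem mainTheorem5
    {r : ℕ} (hr : 1 ≤ r) (n : Fin r → ℕ) (hn : ∀ j, 1 ≤ n j)
    {Ω : ℕ → Type*} [∀ N, MeasurableSpace (Ω N)]
    (μ : (N : ℕ) → Measure (Ω N)) [∀ N, IsProbabilityMeasure (μ N)]
    (X : (N : ℕ) → Ω N → Matrix (Fin N) (Fin N) ℂ)
    (hX : ∀ N, IsComplexGaussianMatrix (μ N) (X N))
    (D : Point n → (N : ℕ) → Matrix (Fin N) (Fin N) ℂ)
    {A : Type*} [Ring A] [StarRing A] [Algebra ℂ A] [StarModule ℂ A]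
    (ψ : A →ₗ[ℂ] ℂ) (hψ : IsTracialState ψ) (d : Point n → A)
    (hD : ConvergesInDistribution D ψ d) :
    (∀ (N : ℕ) (B : Finset (Fin r)),
      Integrable (fun ω => ∏ j ∈ B, wishartTrace n (X N ω) (fun x => D x N) j) (μ N)) ∧
    Tendsto
      (fun N : ℕ => (N : ℂ) ^ ((r : ℤ) - 2) *
        cumulant (μ N) (fun j ω => wishartTrace n (X N ω) (fun x => D x N) j))
      atTop
      (𝓝 (∑ π ∈ SNC n, psiPerm (fun a => ψ a) π d)) := by
  classical
  refine ⟨fun N B => (HasAllMoments.prod B fun j _ =>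
    hasAllMoments_wishartTrace (hX N) n (fun x => D x N) j).integrable, ?_⟩
  have hterm : ∀ σ : Equiv.Perm (Point n), Tendsto (fun N : ℕ => (N : ℂ) ^ ((r : ℤ) - 2) *
      if ∀ x y : Point n, ∃ g ∈ Subgroup.closure {σ, gammaPerm n}, g x = y then
        genusWeight (fun x => D x N) σ else 0) atTop
      (𝓝 (if IsAnnularNonCrossing n σ then psiPerm (fun a => ψ a) σ d else 0)) := fun σ => by
    unfold IsAnnularNonCrossing
    by_cases hσ : ∀ x y : Point n, ∃ g ∈ Subgroup.closure {σ, gammaPerm n}, g x = y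
    · simp only [if_pos hσ, and_iff_right hσ]
      exact tendsto_genusWeight hn hD σ hσ
    · simp only [if_neg hσ, mul_zero, if_neg fun h => hσ (And.left h)]
      exact tendsto_const_nhds
  have hsum := tendsto_finsetSum Finset.univ fun σ _ => hterm σ
  rw [← Finset.sum_filter] at hsum
  refine Tendsto.congr' ?_ (hsum.congr fun N => (Finset.mul_sum _ _ _).symm) |>.trans_eq ?_
  · filter_upwards [eventually_ne_atTop 0] with N hN
    rw [cumulant_wishartTrace (hX N) hN hr hn]
  · rfl
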